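/- **Theorem.** Write every cycle of a permutation $\sigma \in S_n$ (fixed points included) as $C = (c_0, c_1, \ldots, c_{p-1})$ with $c_{i+1} = \sigma(c_i)$ and $c_0$ its smallest element, and read indices modulo the length $p$. Say that $\sigma$ has a cycle $132$-match if for some cycle of $\sigma$ of length $p \ge 3$ and some $r$ the word $c_r\,c_{r+1}\,c_{r+2}$ is in the same relative order as $1\,3\,2$. Put $\mathrm{cdes}(C) = 1 + |\{0 \le i < p-1 : c_i > c_{i+1}\}|$, let $\mathrm{cdes}(\sigma)$ be the sum of $\mathrm{cdes}(C)$ over the cycles $C$ of $\sigma$, and let $\mathrm{cyc}(\sigma)$ be the number of cycles of $\sigma$. Let $\mathcal{NCM}_n$ be the set of $\sigma \in S_n$ with no cycle $132$-match, let $\mathcal{L}_m$ be the set of $m$-cycles in $S_m$ with no cycle $132$-match, and define the formal power series in $t$ $$NCM_{132}(t,x,y) = 1 + \sum_{n \ge 1} \frac{t^n}{n!} \sum_{\sigma \in \mathcal{NCM}_n} x^{\mathrm{cyc}(\sigma)} y^{\mathrm{cdes}(\sigma)}, \qquad D(t,y) = 1 - y\int_0^t e^{(1-y)s - y s^2/2}\,ds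 .$$ For a formal power series $f$ in $t$ with constant term $1$, let $f^{a} = e^{a \ln f}$. Then $$\sum_{m \ge 1} \frac{t^m}{m!} \sum_{C \in \mathcal{L}_m} y^{\mathrm{cdes}(C)} = \ln\frac{1}{D(t,y)}$$ and $$NCM_{132}(t,x,y) = e^{x \ln (1/D(t,y))} = \frac{1}{D(t,y)^{x}} = D(t,y)^{-x}.$$ These are identities of formal power series in $t$, for indeterminates $x, y$ over $\mathbb{Q}$, or for any elements $x, y$ of a commutative $\mathbb{Q}$-algebra. -/

import Mathlib

namespace CyclePattern

/-! ### Cycles of a permutation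

A permutation of `{1, …, n}` is a term `σ : Equiv.Perm (Fin n)`. Each cycle (fixed points included)
is written `(c_0, …, c_{p-1})` with `c_0` its smallest element and `c_{i+1} = σ c_i`, and is
represented by `c_0`. -/

/-- The smallest elements of the cycles of `σ`: one element for each cycle, fixed points included. -/
def cycleMins {n : ℕ} (σ : Equiv.Perm (Fin n)) : Finset (Fin n) :=
  Finset.univ.filter fun c => ∀ d, σ.SameCycle c d → c ≤ d

/-- The number of cycles of `σ`, fixed points included. -/
def cyc {n : ℕ} (σ : Equiv.Perm (Fin n)) : ℕ := (cycleMins σ).card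

/-- The length `p` of the cycle containing `c`. -/
def cycleLen {n : ℕ} (σ : Equiv.Perm (Fin n)) (c : Fin n) : ℕ :=
  (Finset.univ.filter fun d => σ.SameCycle c d).card

/-- The entry `c_i` of the cycle `(c_0, …, c_{p-1})` with `c_0 = c`, the index being
read modulo the length `p` of the cycle. -/
def cycleEntry {n : ℕ} (σ : Equiv.Perm (Fin n)) (c : Fin n) (i : ℕ) : Fin n :=
  (σ ^ (i % cycleLen σ c)) c

/-- `cdes C = 1 + des (c_0 ⋯ c_{p-1})` for the cycle `C = (c_0, …, c_{p-1})` with `c_0 = c`. -/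
def cycleDes {n : ℕ} (σ : Equiv.Perm (Fin n)) (c : Fin n) : ℕ :=
  1 + ((Finset.range (cycleLen σ c - 1)).filter fun i =>
    cycleEntry σ c (i + 1) < cycleEntry σ c i).card

/-- `cdes σ` is the sum of `cdes C` over all cycles `C` of `σ`. -/
def cdes {n : ℕ} (σ : Equiv.Perm (Fin n)) : ℕ := ∑ c ∈ cycleMins σ, cycleDes σ c

/-! ### Cycle matches -/

/-- The reduction of a word with distinct letters: its `i`-th smallest letter is replaced by `i`. -/
def red {j n : ℕ} (w : Fin j → Fin n) : Fin j → ℕ :=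
  fun a => (Finset.univ.filter fun b => w b ≤ w a).card

/-- The word `τ_1 ⋯ τ_j`, with letters in `{1, …, j}`, of `τ ∈ S_j`. -/
def oneLine {j : ℕ} (τ : Equiv.Perm (Fin j)) : Fin j → ℕ := fun a => (τ a : ℕ) + 1

/-- `σ` has a cycle `τ`-match: for some cycle `(c_0, …, c_{p-1})` of `σ` with `p ≥ j` and some `r`,
`red (c_r c_{r+1} ⋯ c_{r+j-1}) = τ`, the indices being read modulo `p`. -/
def HasCycleMatch {j n : ℕ} (τ : Equiv.Perm (Fin j)) (σ : Equiv.Perm (Fin n)) : Prop :=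
  ∃ c ∈ cycleMins σ, j ≤ cycleLen σ c ∧ ∃ r ∈ Finset.range (cycleLen σ c),
    red (fun a : Fin j => cycleEntry σ c (r + a)) = oneLine τ

instance {j n : ℕ} (τ : Equiv.Perm (Fin j)) (σ : Equiv.Perm (Fin n)) :
    Decidable (HasCycleMatch τ σ) := by
  unfold HasCycleMatch; infer_instance

/-- The permutations in `S_n` without cycle `τ`-matches. -/
def ncmPerms {j : ℕ} (τ : Equiv.Perm (Fin j)) (n : ℕ) : Finset (Equiv.Perm (Fin n)) :=
  Finset.univ.filter fun σ => ¬ HasCycleMatch τ σ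

/-- The `m`-cycles in `S_m` (permutations consisting of exactly one cycle) without
cycle `τ`-matches. -/
def ncmCycles {j : ℕ} (τ : Equiv.Perm (Fin j)) (m : ℕ) : Finset (Equiv.Perm (Fin m)) :=
  (ncmPerms τ m).filter fun σ => cyc σ = 1

/-- The permutation `1 3 2` of `S_3`. -/
def pat132 : Equiv.Perm (Fin 3) := Equiv.swap 1 2

/-! ### Generating functions, as formal power series in `t` over a commutative `ℚ`-algebra -/

section Series

variable {R : Type*} [CommRing R] [Algebra ℚ R]

/-- `NCM_τ(t,x,y) = ∑_{n ≥ 0} (t^n / n!) ∑_σ x^{cyc σ} y^{cdes σ}`, over the `σ ∈ S_n` without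
cycle `τ`-matches. -/
noncomputable def NCM {j : ℕ} (τ : Equiv.Perm (Fin j)) (x y : R) : PowerSeries R :=
  PowerSeries.mk fun n =>
    ((1 : ℚ) / (n.factorial : ℚ)) • ∑ σ ∈ ncmPerms τ n, x ^ cyc σ * y ^ cdes σ

/-- `∑_{m ≥ 1} (t^m / m!) ∑_C y^{cdes C}`, over the `m`-cycles `C ∈ S_m` without cycle `τ`-matches.
(There is no `0`-cycle, so the coefficient for `m = 0` is an empty sum.) -/
noncomputable def cycleSeries {j : ℕ} (τ : Equiv.Perm (Fin j)) (y : R) : PowerSeries R :=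
  PowerSeries.mk fun m =>
    ((1 : ℚ) / (m.factorial : ℚ)) • ∑ C ∈ ncmCycles τ m, y ^ cdes C

/-- The exponential `e^f` of a power series `f` with zero constant term. -/
noncomputable def expOf (f : PowerSeries R) : PowerSeries R := (PowerSeries.exp R).subst f

/-- The integral `∫_0^t f(s) ds`. -/
noncomputable def integral (f : PowerSeries R) : PowerSeries R :=
  PowerSeries.mk fun n => ((1 : ℚ) / (n : ℚ)) • (if n = 0 then 0 else PowerSeries.coeff (n - 1) f)

/-- The multiplicative inverse `1 / f` of a power series `f` with constant term `1`. -/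
noncomputable def recip (f : PowerSeries R) : PowerSeries R := PowerSeries.invOfUnit f 1

/-- The power `f ^ a = e^{a ln f}` of a power series `f` with constant term `1`. -/
noncomputable def powOf (f : PowerSeries R) (a : R) : PowerSeries R :=
  expOf (PowerSeries.C a * PowerSeries.logOf f)

/-- `1 - y ∫_0^t e^{(1-y) s - y s^2 / 2} ds`. -/
noncomputable def denom132 (y : R) : PowerSeries R :=
  1 - PowerSeries.C y * integral (expOf
    (PowerSeries.C (1 - y) * PowerSeries.X
      - ((1 : ℚ) / 2) • (PowerSeries.C y * PowerSeries.X ^ 2)))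

end Series

end CyclePattern

namespace CyclePattern

open PowerSeries Finset

/-! Let `L` be the exponential generating function of the cycles, `N` that of the permutations, and
`F` the case `x = 1` of `N`. Both the statistic and the pattern are local: `cdes σ` counts the `d`
with `σ d ≤ d` (`cdes_eq`), and a match is a `d` with `d < σ (σ d) < σ d`
(`hasCycleMatch_pat132_iff`). Hence they are compatible with splitting off one cycle, and removing
the cycle of `0` gives `N' = x L' N` (`permSum_succ`).

A second relation comes from left multiplication by the transposition `(0 1)`, which exchanges the
permutations having `0` and `1` in one cycle with those having them in two. Starting from two
cycles, it preserves weight and avoidance, with two exceptions: if `0` is fixed, `cdes` drops by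
one; if `0` lies in a 2-cycle, a match is created. Both exceptional classes can be enumerated, so
`F'' + (1 - y) F' - y t F' = 2 L'' F` (`permSum_one_add_two`).

With `F' = L' F` this becomes linear for `H = 1 / F`: `H'' = ((1 - y) - y t) H'`, `H(0) = 1`, `H'(0)
= -y`. The series `D` solves the same problem, so `D F = 1` (`denom132_mul_eq_one`), and the
logarithm and power formulas follow by comparing derivatives (`log_exp_identities`). -/

theorem recip_eq_of_mul_eq_one {R : Type*} [CommRing R] {f g : PowerSeries R} (hf : constantCoeff f = 1)
    (h : f * g = 1) : recip f = g := by
  have h1 : f * recip f = 1 := mul_invOfUnit f 1 (by simpa using hf)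
  linear_combination g * h1 - recip f * h

/-! ### Formal power series: differential equations, exponentials, logarithms. -/

section Series

variable {R : Type*} [CommRing R] [Algebra ℚ R]

theorem eq_zero_of_natCast_succ_mul_eq_zero (n : ℕ) {a : R} (h : a * ((n : R) + 1) = 0) : a = 0 := by
  have hu : ((n : R) + 1) * algebraMap ℚ R (1 / ((n : ℚ) + 1)) = 1 := by
    have h1 : ((n : R) + 1) = algebraMap ℚ R ((n : ℚ) + 1) := by simp
    rw [h1, ← map_mul, mul_one_div_cancel (by positivity), map_one]
  calc a = a * (((n : R) + 1) * algebraMap ℚ R (1 / ((n : ℚ) + 1))) := by rw [hu, mul_one]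
    _ = 0 := by rw [← mul_assoc, h, zero_mul]

/-- A solution of `u' = c u` with vanishing constant term vanishes. -/
theorem eq_zero_of_derivative_eq_mul {c u : PowerSeries R} (hu : d⁄dX R u = c * u)
    (h0 : constantCoeff u = 0) : u = 0 := by
  ext n
  induction n using Nat.strong_induction_on with
  | _ n ih =>
    cases n with
    | zero => simpa using h0
    | succ n =>
      -- The ring may have zero divisors, but `n + 1` is invertible in a `ℚ`-algebra; the derivative
      -- then expresses coefficient `n + 1` through earlier ones.
      apply eq_zero_of_natCast_succ_mul_eq_zero n
      rw [← coeff_derivative, hu, coeff_mul]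
      refine Finset.sum_eq_zero fun q hq => ?_
      rw [ih q.2 (by have := mem_antidiagonal.mp hq; omega), map_zero, mul_zero]

theorem eq_of_derivative_eq_mul {c u v : PowerSeries R} (hu : d⁄dX R u = c * u)
    (hv : d⁄dX R v = c * v) (h0 : constantCoeff u = constantCoeff v) : u = v :=
  sub_eq_zero.mp <| eq_zero_of_derivative_eq_mul (c := c) (by rw [map_sub, hu, hv, mul_sub])
    (by rw [map_sub, h0, sub_self])

theorem eq_of_derivative_eq {u v : PowerSeries R} (h : d⁄dX R u = d⁄dX R v)
    (h0 : constantCoeff u = constantCoeff v) : u = v :=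
  sub_eq_zero.mp <| eq_zero_of_derivative_eq_mul (c := 0) (by rw [map_sub, h, sub_self, zero_mul])
    (by rw [map_sub, h0, sub_self])

theorem derivative_expOf {f : PowerSeries R} (hf : constantCoeff f = 0) :
    d⁄dX R (expOf f) = d⁄dX R f * expOf f := by
  rw [expOf, derivative_subst (HasSubst.of_constantCoeff_zero' hf), derivative_exp, mul_comm]

theorem constantCoeff_expOf {f : PowerSeries R} (hf : constantCoeff f = 0) :
    constantCoeff (expOf f) = 1 := by
  have h : exp R = 1 + (exp R - 1) := by ring
  have hs := HasSubst.of_constantCoeff_zero' hf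
  have h1 : (1 : PowerSeries R).subst f = 1 := by
    rw [← coe_substAlgHom hs, map_one]
  have h0 : constantCoeff ((exp R - 1).subst f) = 0 :=
    constantCoeff_subst_eq_zero hf _ (by simp [constantCoeff_exp])
  rw [expOf, h, subst_add hs, map_add, h1, h0, map_one, add_zero]

/-- Substitute `f - 1` for `X` in `(1 + X) * log' = 1` and apply the chain rule. -/
theorem mul_derivative_logOf {f : PowerSeries R} (hf : constantCoeff f = 1) :
    f * d⁄dX R (logOf f) = d⁄dX R f := by
  have hs : HasSubst (f - 1) := HasSubst.of_constantCoeff_zero' (by simp [hf])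
  have hlog : (1 + X) * d⁄dX R (log R) = 1 := by
    rw [deriv_log]
    ext n
    cases n with
    | zero => simp
    | succ n => simp [add_mul, coeff_succ_X_mul, pow_succ, coeff_one]
  have h1 : (1 + X : PowerSeries R).subst (f - 1) = f := by
    rw [subst_add hs, subst_X hs, ← coe_substAlgHom hs, map_one]; ring
  have h2 : f * (d⁄dX R (log R)).subst (f - 1) = 1 := by
    have := congrArg (fun g : PowerSeries R => g.subst (f - 1)) hlog
    simp only [subst_mul hs, h1] at this
    rw [this, ← coe_substAlgHom hs, map_one]
  rw [logOf_eq, derivative_subst hs, ← mul_assoc, h2, one_mul, map_sub, derivative_one, sub_zero]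

theorem derivative_integral (f : PowerSeries R) : d⁄dX R (integral f) = f := by
  ext n
  rw [coeff_derivative, integral, coeff_mk, if_neg n.succ_ne_zero, Nat.add_sub_cancel,
    Algebra.smul_def]
  have h1 : ((n : R) + 1) = algebraMap ℚ R ((n : ℚ) + 1) := by simp
  rw [h1, mul_right_comm, ← map_mul]
  have h2 : (1 : ℚ) / ((n + 1 : ℕ) : ℚ) * ((n : ℚ) + 1) = 1 := by
    push_cast; field_simp
  rw [h2, map_one, one_mul]

theorem constantCoeff_integral (f : PowerSeries R) : constantCoeff (integral f) = 0 := by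
  rw [← coeff_zero_eq_constantCoeff_apply, integral, coeff_mk]; simp

/-- The exponential generating function of a sequence. -/
noncomputable def egf (a : ℕ → R) : PowerSeries R :=
  PowerSeries.mk fun n => ((1 : ℚ) / (n.factorial : ℚ)) • a n

theorem constantCoeff_egf (a : ℕ → R) : constantCoeff (egf a) = a 0 := by
  rw [← coeff_zero_eq_constantCoeff_apply, egf, coeff_mk]; simp

theorem derivative_egf (a : ℕ → R) : d⁄dX R (egf a) = egf fun n => a (n + 1) := by
  ext n
  rw [coeff_derivative, egf, egf, coeff_mk, coeff_mk]
  have h1 : ((n : R) + 1) = algebraMap ℚ R ((n : ℚ) + 1) := by simp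
  rw [h1, mul_comm, ← Algebra.smul_def, smul_smul]
  congr 1
  rw [Nat.factorial_succ]
  push_cast
  field_simp

theorem egf_mul (a b : ℕ → R) :
    egf a * egf b = egf fun n => ∑ k ∈ range (n + 1), (n.choose k : R) * (a k * b (n - k)) := by
  ext n
  rw [coeff_mul, egf, egf, egf, coeff_mk,
    Nat.sum_antidiagonal_eq_sum_range_succ_mk, Finset.smul_sum]
  refine Finset.sum_congr rfl fun k hk => ?_
  rw [coeff_mk, coeff_mk, smul_mul_smul_comm, ← nsmul_eq_mul, ← Nat.cast_smul_eq_nsmul ℚ, smul_smul,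
    Nat.cast_choose ℚ (by have := mem_range.mp hk; omega : k ≤ n)]
  congr 1
  field_simp

theorem egf_add (a b : ℕ → R) : egf a + egf b = egf fun n => a n + b n := by
  ext n; simp [egf]

theorem C_mul_egf (c : R) (a : ℕ → R) : C c * egf a = egf fun n => c * a n := by
  ext n; simp [egf]

theorem X_mul_derivative_egf (a : ℕ → R) :
    X * d⁄dX R (egf a) = egf fun n => (n : R) * a n := by
  ext n
  cases n with
  | zero => simp [egf]
  | succ n =>
    rw [coeff_succ_X_mul, coeff_derivative, egf, egf, coeff_mk, coeff_mk, mul_comm,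
      mul_smul_comm]
    push_cast; rfl

/-- The exponent in the definition of `denom132`. -/
noncomputable def exponent132 (y : R) : PowerSeries R :=
  C (1 - y) * X - ((1 : ℚ) / 2) • (C y * X ^ 2)

theorem constantCoeff_exponent132 (y : R) : constantCoeff (exponent132 y) = 0 := by
  rw [← coeff_zero_eq_constantCoeff_apply]
  simp [exponent132]

theorem derivative_exponent132 (y : R) :
    d⁄dX R (exponent132 y) = C (1 - y) - C y * X := by
  have h2 : ((1 : ℚ) / 2) • (2 : PowerSeries R) = 1 := by
    have : (2 : PowerSeries R) = (2 : ℚ) • (1 : PowerSeries R) := by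
      rw [Algebra.smul_def, mul_one, map_ofNat]
    rw [this, smul_smul]; norm_num
  have h3 : d⁄dX R (((1 : ℚ) / 2) • (C y * X ^ 2)) = ((1 : ℚ) / 2) • d⁄dX R (C y * X ^ 2) := by
    ext n
    simp only [coeff_derivative, coeff_smul, smul_mul_assoc]
  rw [exponent132, map_sub, h3]
  simp only [Derivation.leibniz, derivative_C, derivative_X, smul_eq_mul, mul_one, mul_zero,
    add_zero, derivative_pow]
  have h4 : C y * (((2 : ℕ) : PowerSeries R) * X ^ (2 - 1)) = 2 * (C y * X) := by
    push_cast; ring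
  rw [h4, ← smul_mul_assoc, h2, one_mul]

theorem constantCoeff_denom132 (y : R) : constantCoeff (denom132 y) = 1 := by
  simp [denom132, constantCoeff_integral]

theorem derivative_denom132 (y : R) :
    d⁄dX R (denom132 y) = -(C y * expOf (exponent132 y)) := by
  rw [denom132, map_sub, derivative_one, Derivation.leibniz, derivative_integral]
  simp [exponent132]

/-- The reciprocal of the solution of the second order equation for the exponential generating
function of the permutations without cycle `132`-matches is `denom132`. -/
theorem denom132_mul_eq_one {y : R} {L F : PowerSeries R} (hF0 : constantCoeff F = 1)
    (hF : d⁄dX R F = d⁄dX R L * F) (hL0 : constantCoeff (d⁄dX R L) = y)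
    (hL : d⁄dX R (d⁄dX R L) * F - d⁄dX R L ^ 2 * F = (C (1 - y) - C y * X) * d⁄dX R F) :
    denom132 y * F = 1 := by
  obtain ⟨H, hH⟩ : ∃ H, H * F = 1 := by
    have : IsUnit F := isUnit_iff_constantCoeff.mpr (by rw [hF0]; exact isUnit_one)
    obtain ⟨H, hH⟩ := this.exists_left_inv
    exact ⟨H, hH⟩
  have hH0 : constantCoeff H = 1 := by
    have := congrArg constantCoeff hH
    rwa [map_mul, hF0, mul_one, map_one] at this
  set l := d⁄dX R L with hl
  have hH1 : d⁄dX R H = -(l * H) := by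
    have h := congrArg (d⁄dX R) hH
    rw [Derivation.leibniz, derivative_one, hF, smul_eq_mul, smul_eq_mul] at h
    linear_combination H * h - (d⁄dX R H + l * H) * hH
  have hl2 : d⁄dX R l - l ^ 2 = (C (1 - y) - C y * X) * l := by
    rw [hF] at hL
    linear_combination H * hL - (d⁄dX R l - l ^ 2 - (C (1 - y) - C y * X) * l) * hH
  -- Passing to `H = 1 / F` linearises the Riccati equation `hl2`, because `H'' = (l ^ 2 - l') H`.
  have hH2 : d⁄dX R (d⁄dX R H) = (C (1 - y) - C y * X) * d⁄dX R H := by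
    rw [hH1, map_neg, Derivation.leibniz, hH1, smul_eq_mul, smul_eq_mul]
    linear_combination -H * hl2
  have hD2 : d⁄dX R (d⁄dX R (denom132 y)) =
      (C (1 - y) - C y * X) * d⁄dX R (denom132 y) := by
    rw [derivative_denom132, map_neg, Derivation.leibniz, derivative_C,
      derivative_expOf (constantCoeff_exponent132 y), derivative_exponent132]
    simp only [smul_eq_mul]
    ring
  -- Both derivatives solve the same first-order equation and have constant term `-y`.
  have hD : d⁄dX R (denom132 y) = d⁄dX R H := by
    refine eq_of_derivative_eq_mul hD2 hH2 ?_
    rw [derivative_denom132, hH1, map_neg, map_neg, map_mul, map_mul, hL0, hH0,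
      constantCoeff_expOf (constantCoeff_exponent132 y)]
    simp
  rw [eq_of_derivative_eq hD (by rw [constantCoeff_denom132, hH0]), hH]

/-- If `L' = F' / F` with `D F = 1` and `N' = x L' N`, then `L`, `N` are given by logarithms and
powers of `D`. -/
theorem log_exp_identities (x : R) {D F L N : PowerSeries R} (hD0 : constantCoeff D = 1)
    (hDF : D * F = 1) (hL0 : constantCoeff L = 0) (hF : d⁄dX R F = d⁄dX R L * F)
    (hN0 : constantCoeff N = 1) (hN : d⁄dX R N = C x * d⁄dX R L * N) :
    L = logOf (recip D) ∧ N = expOf (C x * logOf (recip D)) ∧ N = recip (powOf D x) ∧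
      N = powOf D (-x) := by
  have hF0 : constantCoeff F = 1 := by
    have := congrArg constantCoeff hDF
    rwa [map_mul, hD0, one_mul, map_one] at this
  have hlogF : L = logOf F := by
    refine eq_of_derivative_eq ?_ (by rw [hL0, constantCoeff_logOf hF0])
    have h := mul_derivative_logOf hF0
    rw [hF] at h
    linear_combination (-D) * h + (d⁄dX R (logOf F) - d⁄dX R L) * hDF
  have hlogD : logOf D = -L := by
    refine eq_of_derivative_eq ?_ (by rw [map_neg, hL0, constantCoeff_logOf hD0, neg_zero])
    have h := mul_derivative_logOf hD0
    have h' := congrArg (d⁄dX R) hDF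
    rw [Derivation.leibniz, derivative_one, hF, smul_eq_mul, smul_eq_mul] at h'
    rw [map_neg]
    linear_combination F * h + h' - (d⁄dX R (logOf D) + d⁄dX R L) * hDF
  have hexp : ∀ z : R, constantCoeff (C z * L) = 0 := fun z => by rw [map_mul, hL0, mul_zero]
  have hder : ∀ z : R, d⁄dX R (expOf (C z * L)) = C z * d⁄dX R L * expOf (C z * L) := fun z => by
    rw [derivative_expOf (hexp z), Derivation.leibniz, derivative_C]; simp
  have hNexp : N = expOf (C x * L) :=
    eq_of_derivative_eq_mul hN (hder x) (by rw [hN0, constantCoeff_expOf (hexp x)])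
  have hpow : ∀ z : R, powOf D z = expOf (C (-z) * L) := fun z => by
    rw [powOf, hlogD, mul_neg, map_neg, neg_mul]
  rw [recip_eq_of_mul_eq_one hD0 hDF, ← hlogF]
  refine ⟨rfl, hNexp, ?_, by rw [hpow, neg_neg, hNexp]⟩
  rw [hpow]
  refine (recip_eq_of_mul_eq_one (constantCoeff_expOf (hexp _)) ?_).symm
  -- The product of `e^{-xL}` and `N` has derivative zero, since `N' = x L' N`.
  refine eq_of_derivative_eq ?_
    (by rw [map_mul, constantCoeff_expOf (hexp _), hN0, one_mul, map_one])
  rw [derivative_one, Derivation.leibniz, hN, hder, map_neg, smul_eq_mul, smul_eq_mul]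
  ring

end Series

open Finset Equiv.Perm

/-! ### Local descriptions of `cdes` and of cycle matches. -/

section LocalForms

variable {n : ℕ} (σ : Equiv.Perm (Fin n))

theorem mem_cycleMins {c : Fin n} : c ∈ cycleMins σ ↔ ∀ d, σ.SameCycle c d → c ≤ d := by
  simp [cycleMins]

theorem exists_mem_cycleMins (d : Fin n) : ∃ c ∈ cycleMins σ, σ.SameCycle c d := by
  obtain ⟨c, hc, hmin⟩ := exists_min_image (univ.filter fun e => σ.SameCycle e d) id
    ⟨d, by simp [SameCycle.refl]⟩
  simp only [mem_filter, mem_univ, true_and, id] at hc hmin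
  exact ⟨c, (mem_cycleMins σ).mpr fun e he => hmin e (he.symm.trans hc), hc⟩

theorem eq_of_mem_cycleMins {c d : Fin n} (hc : c ∈ cycleMins σ) (hd : d ∈ cycleMins σ)
    (h : σ.SameCycle c d) : c = d :=
  le_antisymm ((mem_cycleMins σ).mp hc d h) ((mem_cycleMins σ).mp hd c h.symm)

theorem pow_injOn_minimalPeriod (c : Fin n) :
    Set.InjOn (fun i => (σ ^ i) c) (range (Function.minimalPeriod σ c) : Set ℕ) := by
  intro i hi j hj h
  refine Function.iterate_injOn_Iio_minimalPeriod (f := σ) (x := c) (by simpa using hi)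
    (by simpa using hj) ?_
  simpa [iterate_eq_pow] using h

theorem filter_sameCycle_eq_image (c : Fin n) : (univ.filter fun d => σ.SameCycle c d) =
    (range (Function.minimalPeriod σ c)).image fun i => (σ ^ i) c := by
  ext d
  simp only [mem_filter, mem_univ, true_and, mem_image, mem_range]
  constructor
  · intro h
    obtain ⟨i, rfl⟩ := h.exists_nat_pow_eq
    refine ⟨i % Function.minimalPeriod σ c, Nat.mod_lt _ ?_, ?_⟩
    · exact Function.minimalPeriod_pos_of_mem_periodicPts (σ.injective.mem_periodicPts c)
    · rw [← iterate_eq_pow, ← iterate_eq_pow, Function.iterate_mod_minimalPeriod_eq]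
  · rintro ⟨i, -, rfl⟩
    exact ⟨i, by simp⟩

theorem cycleLen_eq_minimalPeriod (c : Fin n) : cycleLen σ c = Function.minimalPeriod σ c := by
  rw [cycleLen, filter_sameCycle_eq_image, card_image_of_injOn (pow_injOn_minimalPeriod σ c),
    card_range]

theorem cycleLen_pos (c : Fin n) : 0 < cycleLen σ c :=
  card_pos.mpr ⟨c, by simp [SameCycle.refl]⟩

theorem pow_cycleLen_apply (c : Fin n) : (σ ^ cycleLen σ c) c = c := by
  rw [cycleLen_eq_minimalPeriod, ← iterate_eq_pow, Function.iterate_minimalPeriod]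

theorem cycleEntry_eq_pow (c : Fin n) (i : ℕ) : cycleEntry σ c i = (σ ^ i) c := by
  rw [cycleEntry, cycleLen_eq_minimalPeriod, ← iterate_eq_pow, ← iterate_eq_pow,
    Function.iterate_mod_minimalPeriod_eq]

theorem pow_succ_apply_ne {c : Fin n} {i : ℕ} (hi : i + 1 < cycleLen σ c) :
    (σ ^ (i + 1)) c ≠ (σ ^ i) c := by
  intro h
  rw [cycleLen_eq_minimalPeriod] at hi
  have := pow_injOn_minimalPeriod σ c (by simpa using hi)
    (by simpa using (Nat.lt_succ_self i).trans hi) h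
  omega

/-- The descents of a cycle, with the number `1` added, count its weak anti-excedances. -/
theorem cycleDes_eq {c : Fin n} (hc : c ∈ cycleMins σ) :
    cycleDes σ c = #{d | σ.SameCycle c d ∧ σ d ≤ d} := by
  obtain ⟨p, hp⟩ : ∃ p, cycleLen σ c = p + 1 := Nat.exists_eq_add_one.mpr (cycleLen_pos σ c)
  -- The summand `1` of `cycleDes` is the closing step from the last entry back to the minimum `c`;
  -- the weak inequality also covers fixed points.
  have hlast : (σ ^ (p + 1)) c ≤ (σ ^ p) c := by
    rw [← hp, pow_cycleLen_apply]
    exact (mem_cycleMins σ).mp hc _ ⟨p, by simp⟩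
  have h1 : #{d | σ.SameCycle c d ∧ σ d ≤ d} =
      #{i ∈ range (p + 1) | (σ ^ (i + 1)) c ≤ (σ ^ i) c} := by
    rw [← filter_filter, filter_sameCycle_eq_image, filter_image, card_image_of_injOn,
      ← cycleLen_eq_minimalPeriod, hp]
    · simp only [pow_succ', mul_apply]
    · exact (pow_injOn_minimalPeriod σ c).mono (by simp +contextual [Set.subset_def])
  rw [h1, range_add_one, filter_insert, if_pos hlast, card_insert_of_notMem (by simp), add_comm,
    cycleDes, hp, Nat.add_sub_cancel]
  congr 2
  refine filter_congr fun i hi => ?_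
  rw [cycleEntry_eq_pow, cycleEntry_eq_pow]
  exact (pow_succ_apply_ne σ (by rw [hp]; simpa using hi)).le_iff_lt.symm

theorem cdes_eq : cdes σ = #{d | σ d ≤ d} := by
  have h : (univ.filter fun d => σ d ≤ d) =
      (cycleMins σ).biUnion fun c => univ.filter fun d => σ.SameCycle c d ∧ σ d ≤ d := by
    ext d
    obtain ⟨c, hc, hcd⟩ := exists_mem_cycleMins σ d
    simp only [mem_filter, mem_univ, true_and, mem_biUnion]
    exact ⟨fun h => ⟨c, hc, hcd, h⟩, fun ⟨_, _, _, h⟩ => h⟩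
  rw [h, card_biUnion, cdes]
  · exact sum_congr rfl fun c hc => cycleDes_eq σ hc
  · intro c hc c' hc' hne
    refine disjoint_left.mpr fun d hd hd' => hne ?_
    simp only [mem_filter, mem_univ, true_and] at hd hd'
    exact eq_of_mem_cycleMins σ hc hc' (hd.1.trans hd'.1.symm)

theorem red_eq_oneLine_pat132_iff (w : Fin 3 → Fin n) :
    red w = oneLine pat132 ↔ w 0 < w 2 ∧ w 2 < w 1 := by
  have e0 : pat132 0 = 0 := by decide
  have e1 : pat132 1 = 2 := by decide
  have e2 : pat132 2 = 1 := by decide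
  simp only [funext_iff, Fin.forall_fin_succ, red, oneLine, card_filter, Fin.sum_univ_three]
  simp [e0, e1, e2]
  split_ifs <;> omega

theorem hasCycleMatch_pat132_iff :
    HasCycleMatch pat132 σ ↔ ∃ d, d < σ (σ d) ∧ σ (σ d) < σ d := by
  simp only [HasCycleMatch, red_eq_oneLine_pat132_iff, cycleEntry_eq_pow]
  have hpow : ∀ c r, (σ ^ (r + ((0 : Fin 3) : ℕ))) c = (σ ^ r) c ∧
      (σ ^ (r + ((1 : Fin 3) : ℕ))) c = σ ((σ ^ r) c) ∧
      (σ ^ (r + ((2 : Fin 3) : ℕ))) c = σ (σ ((σ ^ r) c)) := fun c r =>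
    ⟨rfl, by simp [pow_succ'], by simp [pow_succ']⟩
  constructor
  · rintro ⟨c, -, -, r, -, h⟩
    rw [(hpow c r).1, (hpow c r).2.1, (hpow c r).2.2] at h
    exact ⟨_, h⟩
  · rintro ⟨d, hd⟩
    obtain ⟨c, hc, hcd⟩ := exists_mem_cycleMins σ d
    have hmem : d ∈ univ.filter fun d => σ.SameCycle c d := by simpa using hcd
    rw [filter_sameCycle_eq_image, ← cycleLen_eq_minimalPeriod] at hmem
    obtain ⟨r, hr, rfl⟩ := mem_image.mp hmem
    refine ⟨c, hc, ?_, r, hr, by rwa [(hpow c r).1, (hpow c r).2.1, (hpow c r).2.2]⟩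
    by_contra hlt
    -- The length condition is automatic: on a cycle of length at most 2, `σ (σ d) = d`, which
    -- contradicts `d < σ (σ d)`.
    have h2 : (σ ^ 2) c = c := by
      have hl := pow_cycleLen_apply σ c
      have := cycleLen_pos σ c
      obtain h | h : cycleLen σ c = 1 ∨ cycleLen σ c = 2 := by omega
      · rw [h, pow_one] at hl
        rw [pow_two, mul_apply, hl, hl]
      · rwa [h] at hl
    have h3 : σ (σ ((σ ^ r) c)) = (σ ^ r) c := by
      rw [← mul_apply, ← mul_apply, ← pow_two, ← pow_add, add_comm, pow_add, mul_apply, h2]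
    rw [h3] at hd
    exact lt_irrefl _ hd.1

theorem cyc_eq_one_iff (c : Fin n) : cyc σ = 1 ↔ ∀ d, σ.SameCycle c d := by
  rw [cyc, card_eq_one]
  constructor
  · rintro ⟨a, ha⟩ d
    have key : ∀ e, σ.SameCycle a e := fun e => by
      obtain ⟨b, hb, hbe⟩ := exists_mem_cycleMins σ e
      rw [ha, mem_singleton] at hb
      exact hb ▸ hbe
    exact (key c).symm.trans (key d)
  · intro h
    obtain ⟨a, ha, hac⟩ := exists_mem_cycleMins σ c
    refine ⟨a, eq_singleton_iff_unique_mem.mpr ⟨ha, fun b hb => ?_⟩⟩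
    exact eq_of_mem_cycleMins σ hb ha ((h b).symm.trans (hac.symm))

theorem mem_ncmPerms_pat132 : σ ∈ ncmPerms pat132 n ↔ ∀ d, d < σ (σ d) → ¬ σ (σ d) < σ d := by
  simp [ncmPerms, hasCycleMatch_pat132_iff]

end LocalForms

/-! ### Splitting a permutation along an invariant set. -/

section Glue

variable {N k l : ℕ} {S : Finset (Fin N)} (hk : #S = k) (hl : #Sᶜ = l)

/-- The permutation that acts on `S` as `a` and on the complement of `S` as `b`, after
relabelling in an increasing way. -/
def glue : Equiv.Perm (Fin k) × Equiv.Perm (Fin l) →* Equiv.Perm (Fin N) :=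
  (finSumEquivOfFinset hk hl).permCongrHom.toMonoidHom.comp (sumCongrHom (Fin k) (Fin l))

theorem glue_apply_inl (ab : Equiv.Perm (Fin k) × Equiv.Perm (Fin l)) (i : Fin k) :
    glue hk hl ab (finSumEquivOfFinset hk hl (Sum.inl i)) =
      finSumEquivOfFinset hk hl (Sum.inl (ab.1 i)) := by
  simp [glue, Equiv.permCongrHom, -finSumEquivOfFinset_inl, -finSumEquivOfFinset_inr]

theorem glue_apply_inr (ab : Equiv.Perm (Fin k) × Equiv.Perm (Fin l)) (i : Fin l) :
    glue hk hl ab (finSumEquivOfFinset hk hl (Sum.inr i)) =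
      finSumEquivOfFinset hk hl (Sum.inr (ab.2 i)) := by
  simp [glue, Equiv.permCongrHom, -finSumEquivOfFinset_inl, -finSumEquivOfFinset_inr]

theorem glue_injective : Function.Injective (glue hk hl) :=
  (finSumEquivOfFinset hk hl).permCongrHom.injective.comp sumCongrHom_injective

theorem finSumEquivOfFinset_inl_lt {i j : Fin k} : finSumEquivOfFinset hk hl (Sum.inl i) <
    finSumEquivOfFinset hk hl (Sum.inl j) ↔ i < j := by simp

theorem finSumEquivOfFinset_inr_lt {i j : Fin l} : finSumEquivOfFinset hk hl (Sum.inr i) <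
    finSumEquivOfFinset hk hl (Sum.inr j) ↔ i < j := by simp

theorem finSumEquivOfFinset_inl_le {i j : Fin k} : finSumEquivOfFinset hk hl (Sum.inl i) ≤
    finSumEquivOfFinset hk hl (Sum.inl j) ↔ i ≤ j := by simp

theorem finSumEquivOfFinset_inr_le {i j : Fin l} : finSumEquivOfFinset hk hl (Sum.inr i) ≤
    finSumEquivOfFinset hk hl (Sum.inr j) ↔ i ≤ j := by simp

theorem finSumEquivOfFinset_inl_mem (i : Fin k) : finSumEquivOfFinset hk hl (Sum.inl i) ∈ S := by
  simp

theorem finSumEquivOfFinset_inr_notMem (i : Fin l) :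
    finSumEquivOfFinset hk hl (Sum.inr i) ∉ S := by
  rw [← mem_compl]; simp

theorem forall_finSumEquivOfFinset {p : Fin N → Prop} : (∀ d, p d) ↔
    (∀ i, p (finSumEquivOfFinset hk hl (Sum.inl i))) ∧
      ∀ i, p (finSumEquivOfFinset hk hl (Sum.inr i)) := by
  rw [← (finSumEquivOfFinset hk hl).forall_congr_right, Sum.forall]

theorem card_filter_finSumEquivOfFinset (p : Fin N → Prop) [DecidablePred p] :
    #{d | p d} = #{i | p (finSumEquivOfFinset hk hl (Sum.inl i))} +
      #{i | p (finSumEquivOfFinset hk hl (Sum.inr i))} := by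
  simp only [card_filter]
  rw [← (finSumEquivOfFinset hk hl).sum_comp, Fintype.sum_sum_type]

variable (ab : Equiv.Perm (Fin k) × Equiv.Perm (Fin l))

theorem glue_sameCycle_inl_inl {i j : Fin k} :
    (glue hk hl ab).SameCycle (finSumEquivOfFinset hk hl (Sum.inl i))
      (finSumEquivOfFinset hk hl (Sum.inl j)) ↔ ab.1.SameCycle i j := by
  refine exists_congr fun z => ?_
  rw [← map_zpow, glue_apply_inl, show (ab ^ z).1 = ab.1 ^ z from map_zpow (MonoidHom.fst _ _) ab z,
    (finSumEquivOfFinset hk hl).injective.eq_iff,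
    Sum.inl_injective.eq_iff]

theorem glue_sameCycle_inr_inr {i j : Fin l} :
    (glue hk hl ab).SameCycle (finSumEquivOfFinset hk hl (Sum.inr i))
      (finSumEquivOfFinset hk hl (Sum.inr j)) ↔ ab.2.SameCycle i j := by
  refine exists_congr fun z => ?_
  rw [← map_zpow, glue_apply_inr, show (ab ^ z).2 = ab.2 ^ z from map_zpow (MonoidHom.snd _ _) ab z,
    (finSumEquivOfFinset hk hl).injective.eq_iff,
    Sum.inr_injective.eq_iff]

theorem not_glue_sameCycle_inl_inr {i : Fin k} {j : Fin l} :
    ¬ (glue hk hl ab).SameCycle (finSumEquivOfFinset hk hl (Sum.inl i))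
      (finSumEquivOfFinset hk hl (Sum.inr j)) := by
  rintro ⟨z, hz⟩
  rw [← map_zpow, glue_apply_inl, (finSumEquivOfFinset hk hl).injective.eq_iff] at hz
  cases hz

theorem cyc_glue : cyc (glue hk hl ab) = cyc ab.1 + cyc ab.2 := by
  have h1 : ∀ i, (∀ d, (glue hk hl ab).SameCycle (finSumEquivOfFinset hk hl (Sum.inl i)) d →
      finSumEquivOfFinset hk hl (Sum.inl i) ≤ d) ↔ ∀ j, ab.1.SameCycle i j → i ≤ j := fun i => by
    rw [forall_finSumEquivOfFinset hk hl]
    simp only [glue_sameCycle_inl_inl, finSumEquivOfFinset_inl_le, not_glue_sameCycle_inl_inr,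
      false_imp_iff, implies_true, and_true]
  have h2 : ∀ i, (∀ d, (glue hk hl ab).SameCycle (finSumEquivOfFinset hk hl (Sum.inr i)) d →
      finSumEquivOfFinset hk hl (Sum.inr i) ≤ d) ↔ ∀ j, ab.2.SameCycle i j → i ≤ j := fun i => by
    rw [forall_finSumEquivOfFinset hk hl]
    simp only [glue_sameCycle_inr_inr, finSumEquivOfFinset_inr_le,
      sameCycle_comm (x := finSumEquivOfFinset hk hl (Sum.inr i)) (y := finSumEquivOfFinset hk hl (Sum.inl _)),
      not_glue_sameCycle_inl_inr, false_imp_iff, implies_true, true_and]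
  rw [cyc, cyc, cyc, cycleMins, cycleMins, cycleMins, card_filter_finSumEquivOfFinset hk hl]
  simp only [h1, h2]

/-- By `cdes_eq` only `d` and its image are compared. They lie on the same side of the partition,
where the relabelling is increasing. The same reason gives `glue_mem_ncmPerms`. -/
theorem cdes_glue : cdes (glue hk hl ab) = cdes ab.1 + cdes ab.2 := by
  rw [cdes_eq, cdes_eq, cdes_eq, card_filter_finSumEquivOfFinset hk hl]
  simp only [glue_apply_inl, glue_apply_inr, finSumEquivOfFinset_inl_le,
    finSumEquivOfFinset_inr_le]

theorem glue_mem_ncmPerms : glue hk hl ab ∈ ncmPerms pat132 N ↔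
    ab.1 ∈ ncmPerms pat132 k ∧ ab.2 ∈ ncmPerms pat132 l := by
  rw [mem_ncmPerms_pat132, mem_ncmPerms_pat132, mem_ncmPerms_pat132,
    forall_finSumEquivOfFinset hk hl]
  simp only [glue_apply_inl, glue_apply_inr, finSumEquivOfFinset_inl_lt,
    finSumEquivOfFinset_inr_lt]

variable {c : Fin N}

theorem sameCycle_glue_iff (hc : c ∈ S) :
    (∀ d, (glue hk hl ab).SameCycle c d ↔ d ∈ S) ↔ cyc ab.1 = 1 := by
  obtain ⟨i, rfl⟩ : ∃ i, finSumEquivOfFinset hk hl (Sum.inl i) = c := by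
    obtain ⟨i | i, rfl⟩ := (finSumEquivOfFinset hk hl).surjective c
    · exact ⟨i, rfl⟩
    · exact absurd hc (finSumEquivOfFinset_inr_notMem hk hl i)
  rw [forall_finSumEquivOfFinset hk hl, cyc_eq_one_iff ab.1 i]
  simp only [glue_sameCycle_inl_inl, finSumEquivOfFinset_inl_mem, iff_true,
    not_glue_sameCycle_inl_inr, finSumEquivOfFinset_inr_notMem, implies_true, and_true]

/-- As `S` is finite, a permutation mapping `S` into itself also preserves the complement. -/
theorem exists_glue_eq {σ : Equiv.Perm (Fin N)} (hσ : ∀ d ∈ S, σ d ∈ S) :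
    ∃ ab, glue hk hl ab = σ := by
  have h := mem_sumCongrHom_range_of_perm_mapsTo_inl
    (σ := (finSumEquivOfFinset hk hl).symm.permCongr σ) (by
      rintro _ ⟨i, rfl⟩
      obtain ⟨j | j, hj⟩ := (finSumEquivOfFinset hk hl).surjective
        (σ (finSumEquivOfFinset hk hl (Sum.inl i)))
      · exact ⟨j, by rw [Equiv.permCongr_apply, Equiv.symm_symm, ← hj, Equiv.symm_apply_apply]⟩
      · exact absurd (hj ▸ hσ _ (finSumEquivOfFinset_inl_mem hk hl i))
          (finSumEquivOfFinset_inr_notMem hk hl j))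
  obtain ⟨ab, hab⟩ := h
  refine ⟨ab, ?_⟩
  rw [glue, MonoidHom.comp_apply, hab]
  ext d
  simp [Equiv.permCongrHom]

include hk hl in
/-- The permutations without cycle matches for which `S` is the cycle of `c` correspond to the
pairs of a cycle on `S` and a permutation of the complement of `S`. -/
theorem sum_ncmPerms_sameCycle_eq {M : Type*} [AddCommMonoid M] (f : ℕ → ℕ → M) (hc : c ∈ S) :
    ∑ σ ∈ ncmPerms pat132 N with (univ.filter fun d => σ.SameCycle c d) = S, f (cyc σ) (cdes σ) =
      ∑ a ∈ ncmCycles pat132 k, ∑ b ∈ ncmPerms pat132 l, f (1 + cyc b) (cdes a + cdes b) := by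
  rw [← sum_product']
  symm
  have hiff : ∀ σ : Equiv.Perm (Fin N), (univ.filter fun d => σ.SameCycle c d) = S ↔
      ∀ d, σ.SameCycle c d ↔ d ∈ S := fun σ => by simp [Finset.ext_iff]
  refine sum_bij (fun ab _ => glue hk hl ab) ?_ ?_ ?_ ?_
  · intro ab hab
    simp only [mem_product, ncmCycles, mem_filter] at hab
    rw [mem_filter, glue_mem_ncmPerms, hiff, sameCycle_glue_iff hk hl ab hc]
    exact ⟨⟨hab.1.1, hab.2⟩, hab.1.2⟩
  · exact fun _ _ _ _ h => glue_injective hk hl h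
  · intro σ hσ
    rw [mem_filter, hiff] at hσ
    obtain ⟨ab, rfl⟩ := exists_glue_eq hk hl (σ := σ) fun d hd => by
      rw [← hσ.2] at hd ⊢
      exact sameCycle_apply_right.mpr hd
    rw [glue_mem_ncmPerms, sameCycle_glue_iff hk hl ab hc] at hσ
    exact ⟨ab, by simpa [ncmCycles, mem_product] using ⟨⟨hσ.1.1, hσ.2⟩, hσ.1.2⟩, rfl⟩
  · intro ab hab
    simp only [mem_product, ncmCycles, mem_filter] at hab
    rw [cyc_glue, cdes_glue, hab.1.2]

end Glue

/-! ### Recursions from removing one cycle, and initial values. -/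

section Recursion

variable {R : Type*} [CommRing R]

/-- The enumerator of the `m`-cycles without cycle `132`-matches. -/
def cycleSum (y : R) (m : ℕ) : R := ∑ C ∈ ncmCycles pat132 m, y ^ cdes C

/-- The enumerator of the permutations without cycle `132`-matches. -/
def permSum (x y : R) (n : ℕ) : R := ∑ σ ∈ ncmPerms pat132 n, x ^ cyc σ * y ^ cdes σ

/-- Deleting `T` turns supersets of `T` into arbitrary subsets of its complement. Here `S` will be a
cycle required to contain `T`. -/
theorem sum_superset_apply_card {α M : Type*} [Fintype α] [DecidableEq α] [AddCommMonoid M]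
    (T : Finset α) (h : ℕ → M) :
    ∑ S with T ⊆ S, h #S = ∑ k ∈ range (#Tᶜ + 1), (#Tᶜ).choose k • h (k + #T) := by
  rw [← sum_powerset_apply_card fun k => h (k + #T)]
  refine sum_nbij' (fun S => S \ T) (fun U => U ∪ T) ?_ ?_ ?_ ?_ ?_
  · intro S _
    simp only [mem_powerset]
    exact fun d hd => mem_compl.mpr (mem_sdiff.mp hd).2
  · intro U _
    simp
  · intro S hS
    exact sdiff_union_of_subset (mem_filter.mp hS).2
  · intro U hU
    rw [union_sdiff_right, _root_.sdiff_eq_self_iff_disjoint]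
    exact disjoint_left.mpr fun d hd' hd => mem_compl.mp (mem_powerset.mp hU hd) hd'
  · intro S hS
    rw [card_sdiff_add_card_eq_card (mem_filter.mp hS).2]

theorem sum_ncmPerms_sameCycle_eq_mul (x y : R) {N k l : ℕ} {S : Finset (Fin N)} {c : Fin N}
    (hk : #S = k) (hl : #Sᶜ = l) (hc : c ∈ S) :
    ∑ σ ∈ ncmPerms pat132 N with (univ.filter fun d => σ.SameCycle c d) = S,
      x ^ cyc σ * y ^ cdes σ = x * (cycleSum y k * permSum x y l) := by
  rw [sum_ncmPerms_sameCycle_eq hk hl (fun i j => x ^ i * y ^ j) hc, cycleSum, permSum,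
    sum_mul_sum, mul_sum]
  refine sum_congr rfl fun a _ => ?_
  rw [mul_sum]
  exact sum_congr rfl fun b _ => by ring

/-- The enumerator of the permutations without cycle `132`-matches for which `T` is contained in
the cycle of `c`. -/
theorem sum_ncmPerms_subset_cycle (x y : R) {N t : ℕ} (T : Finset (Fin (N + t))) {c : Fin (N + t)}
    (hT : #T = t) (hc : c ∈ T) :
    ∑ σ ∈ ncmPerms pat132 (N + t) with T ⊆ univ.filter fun d => σ.SameCycle c d,
        x ^ cyc σ * y ^ cdes σ =
      x * ∑ k ∈ range (N + 1), (N.choose k : R) * (cycleSum y (k + t) * permSum x y (N - k)) := by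
  have hTc : #Tᶜ = N := by rw [card_compl, Fintype.card_fin, hT, Nat.add_sub_cancel]
  have h := sum_superset_apply_card T
    fun s => x * (cycleSum y s * permSum x y (N + t - s))
  rw [hTc, hT] at h
  rw [mul_sum]
  have h2 : ∀ k ∈ range (N + 1), x * ((N.choose k : R) *
      (cycleSum y (k + t) * permSum x y (N - k))) = N.choose k •
        (x * (cycleSum y (k + t) * permSum x y (N + t - (k + t)))) := fun k _ => by
    rw [Nat.add_sub_add_right, nsmul_eq_mul]; ring
  -- Classify the permutations by the exact cycle `S ⊇ T` of `c`; each class contributes an amount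
  -- depending only on `#S`.
  rw [sum_congr rfl h2, ← h, ← sum_fiberwise_of_maps_to
    (g := fun σ : Equiv.Perm (Fin (N + t)) => univ.filter fun d => σ.SameCycle c d)
    (t := univ.filter fun S => T ⊆ S) (fun σ hσ => by simpa using (mem_filter.mp hσ).2)]
  refine sum_congr rfl fun S hS => ?_
  have hTS : T ⊆ S := (mem_filter.mp hS).2
  rw [← sum_ncmPerms_sameCycle_eq_mul x y (S := S) rfl
    (by rw [card_compl, Fintype.card_fin]) (hTS hc), filter_filter]
  refine sum_congr (filter_congr fun σ _ => ?_) fun _ _ => rfl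
  exact ⟨fun h => h.2, fun h => ⟨h ▸ hTS, h⟩⟩

/-- The case `T = {0}`, which imposes no condition. In generating functions: `N' = x L' N`. -/
theorem permSum_succ (x y : R) (n : ℕ) : permSum x y (n + 1) =
    x * ∑ k ∈ range (n + 1), (n.choose k : R) * (cycleSum y (k + 1) * permSum x y (n - k)) := by
  rw [← sum_ncmPerms_subset_cycle x y {0} (card_singleton _) (mem_singleton_self _), permSum]
  congr 1
  exact (filter_true_of_mem fun σ _ => by simp [SameCycle.refl]).symm

/-- The case `T = {0, 1}`; the right-hand side is the coefficient sequence of `L'' F`. -/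
theorem sum_ncmPerms_sameCycle_zero_one (y : R) (m : ℕ) :
    ∑ σ ∈ ncmPerms pat132 (m + 2) with σ.SameCycle 0 1, y ^ cdes σ =
      ∑ k ∈ range (m + 1), (m.choose k : R) * (cycleSum y (k + 2) * permSum 1 y (m - k)) := by
  have h := sum_ncmPerms_subset_cycle (1 : R) y (N := m) (t := 2) {0, 1} (c := 0)
    (card_pair (by simp)) (by simp)
  simp only [one_pow, one_mul] at h
  rw [← h]
  congr 1
  exact filter_congr fun σ _ => by simp [insert_subset_iff, SameCycle.refl]

theorem permSum_zero (x y : R) : permSum x y 0 = 1 := by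
  have h : ncmPerms pat132 0 = {1} := by decide
  simp [permSum, h, cyc, cdes, cycleMins]

theorem cycleSum_zero (y : R) : cycleSum y 0 = 0 := by
  have h : ncmCycles pat132 0 = ∅ := by decide
  simp [cycleSum, h]

theorem ncmCycles_one : ncmCycles pat132 1 = {1} := by
  ext σ
  obtain rfl := Subsingleton.elim 1 σ
  have h : cyc (1 : Equiv.Perm (Fin 1)) = 1 := (cyc_eq_one_iff 1 0).mpr fun d => by
    rw [Subsingleton.elim d 0]
  simp [ncmCycles, mem_ncmPerms_pat132, h]

theorem cdes_one_one : cdes (1 : Equiv.Perm (Fin 1)) = 1 := by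
  rw [cdes_eq]; decide

theorem ncmCycles_two : ncmCycles pat132 2 = {Equiv.swap 0 1} := by
  ext σ
  have h : σ = 1 ∨ σ = Equiv.swap 0 1 := by
    revert σ; decide
  obtain rfl | rfl := h
  · simp only [ncmCycles, mem_filter, cyc_eq_one_iff (1 : Equiv.Perm (Fin 2)) 0, mem_singleton]
    constructor
    · intro h
      simpa using h.2 1
    · intro h
      exact absurd (congrArg (fun σ : Equiv.Perm (Fin 2) => σ 0) h) (by decide)
  · simp only [ncmCycles, mem_filter, cyc_eq_one_iff (Equiv.swap (0 : Fin 2) 1) 0, mem_singleton,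
      mem_ncmPerms_pat132, iff_true]
    refine ⟨by decide, ?_⟩
    rw [Fin.forall_fin_two]
    exact ⟨SameCycle.refl _ _, ⟨1, by simp⟩⟩

theorem cycleSum_one (y : R) : cycleSum y 1 = y := by
  rw [cycleSum, ncmCycles_one, sum_singleton, cdes_one_one, pow_one]

theorem cycleSum_two (y : R) : cycleSum y 2 = y := by
  have h : cdes (Equiv.swap (0 : Fin 2) 1) = 1 := by rw [cdes_eq]; decide
  rw [cycleSum, ncmCycles_two, sum_singleton, h, pow_one]

end Recursion

/-! ### Multiplication by a transposition joins or splits cycles. -/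

section Swap

variable {n : ℕ} {σ : Equiv.Perm (Fin n)} {c e : Fin n}

theorem mem_of_sameCycle {S : Set (Fin n)} (hS : ∀ d ∈ S, σ d ∈ S) (hc : c ∈ S)
    (h : σ.SameCycle c e) : e ∈ S := by
  obtain ⟨i, rfl⟩ := h.exists_nat_pow_eq
  induction i with
  | zero => exact hc
  | succ i ih =>
    rw [pow_succ', mul_apply]
    exact hS _ (ih ⟨i, by simp⟩)

/-- The two orbits of `c` agree until `σ` first hits `c` or `e`. At that moment the transposition
redirects: a return to `c` becomes a visit to `e` (joining), and an arrival at `e` becomes a return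
to `c` (splitting). -/
theorem pow_swap_mul_apply {p : ℕ} (h : ∀ i, 0 < i → i < p → (σ ^ i) c ≠ c ∧ (σ ^ i) c ≠ e) :
    ∀ i < p, ((Equiv.swap c e * σ) ^ i) c = (σ ^ i) c := by
  intro i
  induction i with
  | zero => exact fun _ => rfl
  | succ i ih =>
    intro hi
    have h1 := h (i + 1) i.succ_pos hi
    rw [pow_succ', mul_apply] at h1
    rw [pow_succ', mul_apply, ih (by omega), mul_apply, Equiv.swap_apply_of_ne_of_ne h1.1 h1.2,
      pow_succ', mul_apply]

theorem pow_swap_mul_apply_succ {p : ℕ}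
    (h : ∀ i, 0 < i → i < p + 1 → (σ ^ i) c ≠ c ∧ (σ ^ i) c ≠ e) :
    ((Equiv.swap c e * σ) ^ (p + 1)) c = Equiv.swap c e ((σ ^ (p + 1)) c) := by
  rw [pow_succ', mul_apply, pow_swap_mul_apply h p p.lt_succ_self, mul_apply, pow_succ', mul_apply]

theorem sameCycle_swap_mul_of_not (h : ¬ σ.SameCycle c e) :
    (Equiv.swap c e * σ).SameCycle c e := by
  obtain ⟨p, hp⟩ : ∃ p, cycleLen σ c = p + 1 := Nat.exists_eq_add_one.mpr (cycleLen_pos σ c)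
  refine ⟨(p + 1 : ℕ), ?_⟩
  rw [zpow_natCast, pow_swap_mul_apply_succ, ← hp, pow_cycleLen_apply, Equiv.swap_apply_left]
  refine fun i h0 hi => ⟨fun hic => ?_, fun hie => h ⟨i, by simpa using hie⟩⟩
  rw [← hp, cycleLen_eq_minimalPeriod] at hi
  have := pow_injOn_minimalPeriod σ c (x₁ := i) (x₂ := 0) (by simpa using hi)
    (by simpa using h0.trans hi) (by simpa using hic)
  omega

theorem not_sameCycle_swap_mul (hce : c ≠ e) (h : σ.SameCycle c e) :
    ¬ (Equiv.swap c e * σ).SameCycle c e := by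
  classical
  have hex : ∃ p, (σ ^ p) c = e := h.exists_nat_pow_eq
  obtain ⟨p, hp⟩ : ∃ p, Nat.find hex = p + 1 := by
    refine Nat.exists_eq_add_one.mpr (Nat.pos_of_ne_zero fun h0 => hce ?_)
    have := Nat.find_spec hex
    rwa [h0] at this
  have hpe : (σ ^ (p + 1)) c = e := hp ▸ Nat.find_spec hex
  have hmin : ∀ i < p + 1, (σ ^ i) c ≠ e := fun i hi => Nat.find_min hex (hp ▸ hi)
  have hne : ∀ i, 0 < i → i < p + 1 → (σ ^ i) c ≠ c ∧ (σ ^ i) c ≠ e := by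
    -- A return to `c` at time `i` would make `e` reachable already at time `p + 1 - i`.
    refine fun i h0 hi => ⟨fun hic => hmin (p + 1 - i) (by omega) ?_, hmin i hi⟩
    rw [← hpe, show p + 1 = (p + 1 - i) + i by omega, pow_add, mul_apply, hic,
      Nat.add_sub_cancel]
  intro hτ
  have hmem := mem_of_sameCycle (S := {d | ∃ i < p + 1, ((Equiv.swap c e * σ) ^ i) c = d}) ?_
    ⟨0, by omega, rfl⟩ hτ
  · obtain ⟨i, hi, hie⟩ := hmem
    rw [pow_swap_mul_apply hne i hi] at hie
    exact hmin i hi hie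
  · rintro _ ⟨i, hi, rfl⟩
    by_cases hip : i = p
    · refine ⟨0, by omega, ?_⟩
      rw [hip, ← mul_apply, ← pow_succ', pow_swap_mul_apply_succ hne, hpe, Equiv.swap_apply_right]
      rfl
    · exact ⟨i + 1, by omega, by rw [pow_succ', mul_apply]⟩

theorem sameCycle_swap_mul_iff (hce : c ≠ e) :
    (Equiv.swap c e * σ).SameCycle c e ↔ ¬ σ.SameCycle c e :=
  ⟨fun h h' => not_sameCycle_swap_mul hce h' h, sameCycle_swap_mul_of_not⟩

end Swap

/-! ### The transposition of the two smallest elements. -/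

section SwapZeroOne

variable {m : ℕ} {σ : Equiv.Perm (Fin (m + 2))}

theorem val_swap_zero_one (d : Fin (m + 2)) : (Equiv.swap 0 1 d : Fin (m + 2)).val =
    if d.val = 0 then 1 else if d.val = 1 then 0 else d.val := by
  rw [Equiv.swap_apply_def]
  simp only [Fin.ext_iff, Fin.val_zero, Fin.val_one]
  split_ifs <;> simp

/-- Exchanging the values `0` and `1` cannot affect `σ d ≤ d` when `d ≥ 1`, and at `d = 0` the value
is neither `0` nor `1`. -/
theorem cdes_swap_mul (h : ¬ σ.SameCycle 0 1) (h0 : σ 0 ≠ 0) :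
    cdes (Equiv.swap 0 1 * σ) = cdes σ := by
  have h1 : σ 0 ≠ 1 := fun h1 => h ⟨1, by simpa using h1⟩
  rw [cdes_eq, cdes_eq]
  congr 1
  refine filter_congr fun d _ => ?_
  rw [mul_apply, Fin.le_def, Fin.le_def, val_swap_zero_one]
  rw [Ne, Fin.ext_iff, Fin.val_zero] at h0
  rw [Ne, Fin.ext_iff, Fin.val_one] at h1
  by_cases hd : d = 0
  · subst hd
    rw [if_neg h0, if_neg h1]
  · have : d.val ≠ 0 := fun h => hd (Fin.ext h)
    split_ifs <;> omega

/-- Only the fixed point `0` is lost from the count, as it is now sent to `1`. -/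
theorem cdes_swap_mul_of_fixed (h0 : σ 0 = 0) : cdes σ = cdes (Equiv.swap 0 1 * σ) + 1 := by
  have h : (univ.filter fun d => σ d ≤ d) =
      insert 0 (univ.filter fun d => (Equiv.swap (0 : Fin (m + 2)) 1 * σ) d ≤ d) := by
    ext d
    simp only [mem_filter, mem_univ, true_and, mem_insert, mul_apply]
    rw [Fin.le_def, Fin.le_def, val_swap_zero_one]
    by_cases hd : d = 0
    · simp [hd, h0]
    · have : d.val ≠ 0 := fun h => hd (Fin.ext h)
      simp only [hd, false_or]
      split_ifs <;> omega
  rw [cdes_eq, cdes_eq, h, card_insert_of_notMem]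
  intro hmem
  have hle := (mem_filter.mp hmem).2
  rw [mul_apply, h0, Equiv.swap_apply_left] at hle
  exact absurd hle (by simp)

/-- A match at `d` needs `σ d ≥ 2`, a value the transposition fixes. Exchanging `0` and `1` in the
position of `σ (σ d)` then matters only for `d = 0`, where `h` and `h0` exclude both values. -/
theorem swap_mul_mem_ncmPerms (h : ¬ σ.SameCycle 0 1) (h0 : σ 0 = 0 ∨ σ (σ 0) ≠ 0) :
    Equiv.swap 0 1 * σ ∈ ncmPerms pat132 (m + 2) ↔ σ ∈ ncmPerms pat132 (m + 2) := by
  rw [mem_ncmPerms_pat132, mem_ncmPerms_pat132]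
  refine forall_congr' fun d => ?_
  simp only [mul_apply]
  have hs := val_swap_zero_one (σ d)
  by_cases hd : (σ d).val < 2
  · simp only [Fin.lt_def]
    split_ifs at hs <;> omega
  · have hsd : Equiv.swap 0 1 (σ d) = σ d := by
      apply Fin.ext
      split_ifs at hs <;> omega
    have hs2 := val_swap_zero_one (σ (σ d))
    rw [hsd]
    by_cases hd0 : d = 0
    · subst hd0
      have h1 : σ (σ 0) ≠ 1 := fun h1 => h ⟨2, by rw [zpow_two, mul_apply, h1]⟩
      have h2 : σ (σ 0) ≠ 0 := h0.resolve_left fun h0 => hd (by simp [h0])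
      rw [Equiv.swap_apply_of_ne_of_ne h2 h1]
    · have : d.val ≠ 0 := fun h => hd0 (Fin.ext h)
      simp only [Fin.lt_def]
      split_ifs at hs2 <;> omega

/-- The 2-cycle `(0, b)` opens up to `0, b, 1` with `b ≥ 2`, a match. -/
theorem swap_mul_notMem_ncmPerms (h : ¬ σ.SameCycle 0 1) (h0 : σ 0 ≠ 0) (h2 : σ (σ 0) = 0) :
    Equiv.swap 0 1 * σ ∉ ncmPerms pat132 (m + 2) := by
  have h1 : σ 0 ≠ 1 := fun h1 => h ⟨1, by simpa using h1⟩
  rw [mem_ncmPerms_pat132]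
  intro hall
  have := hall 0
  simp only [mul_apply, Equiv.swap_apply_of_ne_of_ne h0 h1, h2, Equiv.swap_apply_left] at this
  refine this (by simp) ?_
  rw [Ne, Fin.ext_iff, Fin.val_zero] at h0
  rw [Ne, Fin.ext_iff, Fin.val_one] at h1
  rw [Fin.lt_def, Fin.val_one]
  omega

theorem filter_sameCycle_eq_singleton_iff {n : ℕ} {σ : Equiv.Perm (Fin n)} {c : Fin n} :
    (univ.filter fun d => σ.SameCycle c d) = {c} ↔ σ c = c := by
  constructor
  · intro h
    have : σ c ∈ univ.filter fun d => σ.SameCycle c d := by simp [SameCycle.refl]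
    rwa [h, mem_singleton] at this
  · intro h
    ext d
    simp only [mem_filter, mem_univ, true_and, mem_singleton]
    refine ⟨fun hd => ?_, fun hd => hd ▸ SameCycle.refl _ _⟩
    exact mem_of_sameCycle (S := {c}) (by simpa using h) rfl hd

theorem filter_sameCycle_eq_pair_iff {n : ℕ} {σ : Equiv.Perm (Fin n)} {c b : Fin n} (hb : b ≠ c) :
    (univ.filter fun d => σ.SameCycle c d) = {c, b} ↔ σ c = b ∧ σ b = c := by
  constructor
  · intro h
    have h1 : ∀ d, σ.SameCycle c d ↔ d = c ∨ d = b := fun d => by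
      simpa using Finset.ext_iff.mp h d
    have hcb : σ c = b := by
      refine ((h1 _).mp (by simp [SameCycle.refl])).resolve_left fun hc => hb ?_
      exact mem_of_sameCycle (S := {c}) (by simpa using hc) rfl ((h1 b).mpr (Or.inr rfl))
    refine ⟨hcb, ((h1 (σ b)).mp (sameCycle_apply_right.mpr ((h1 b).mpr (Or.inr rfl)))).resolve_right
      fun h => hb (σ.injective (h.trans hcb.symm))⟩
  · rintro ⟨h1, h2⟩
    ext d
    simp only [mem_filter, mem_univ, true_and, mem_insert, mem_singleton]
    constructor
    · exact fun hd => mem_of_sameCycle (S := {c, b})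
        (by rintro _ (rfl | rfl) <;> simp [h1, h2]) (by simp) hd
    · rintro (rfl | rfl)
      · exact SameCycle.refl _ _
      · exact ⟨1, by simpa using h1⟩

variable {R : Type*} [CommRing R]

theorem sum_ncmPerms_fixed (y : R) (m : ℕ) :
    ∑ σ ∈ ncmPerms pat132 (m + 2) with σ 0 = 0, (y ^ (cdes σ - 1) - y ^ cdes σ) =
      (1 - y) * permSum 1 y (m + 1) := by
  -- The weight involves `cdes σ - 1`, hence the general weight function. The fixed point `0`
  -- contributes `1` to `cdes`, so the truncated subtraction is exact.
  have h := sum_ncmPerms_sameCycle_eq (S := ({0} : Finset (Fin (m + 2)))) (k := 1) (l := m + 1)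
    (c := 0) (card_singleton _) (by rw [card_compl, Fintype.card_fin, card_singleton]; rfl)
    (fun _ j => y ^ (j - 1) - y ^ j) (mem_singleton_self _)
  simp only [filter_sameCycle_eq_singleton_iff] at h
  rw [h, ncmCycles_one, sum_singleton, cdes_one_one, permSum, mul_sum]
  refine sum_congr rfl fun b _ => ?_
  rw [Nat.add_sub_cancel_left]
  ring

theorem sum_ncmPerms_transposed (y : R) (m : ℕ) :
    ∑ σ ∈ ncmPerms pat132 (m + 2) with ¬ σ.SameCycle 0 1 ∧ σ 0 ≠ 0 ∧ σ (σ 0) = 0, y ^ cdes σ =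
      m * (y * permSum 1 y m) := by
  -- The partner `b = σ 0` of `0` has `m` possible values, `b = 1` being excluded; each 2-cycle has
  -- weight `y`.
  rw [← sum_fiberwise_of_maps_to (g := fun σ : Equiv.Perm (Fin (m + 2)) => σ 0)
    (t := ({0, 1} : Finset (Fin (m + 2)))ᶜ)]
  · have hcard : #({0, 1} : Finset (Fin (m + 2)))ᶜ = m := by
      rw [card_compl, Fintype.card_fin, card_pair (by simp), Nat.add_sub_cancel]
    rw [sum_congr rfl (g := fun _ => y * permSum 1 y m), sum_const, hcard, nsmul_eq_mul]
    intro b hb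
    simp only [mem_compl, mem_insert, mem_singleton, not_or] at hb
    have h := sum_ncmPerms_sameCycle_eq_mul (1 : R) y (S := ({0, b} : Finset (Fin (m + 2))))
      (k := 2) (l := m) (c := 0) (card_pair (Ne.symm hb.1))
      (by rw [card_compl, Fintype.card_fin, card_pair (Ne.symm hb.1), Nat.add_sub_cancel])
      (by simp)
    simp only [one_pow, one_mul, cycleSum_two] at h
    rw [← h, filter_filter]
    refine sum_congr (filter_congr fun σ _ => ?_) fun _ _ => rfl
    rw [filter_sameCycle_eq_pair_iff hb.1]
    constructor
    · rintro ⟨⟨-, -, h2⟩, rfl⟩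
      exact ⟨rfl, h2⟩
    · rintro ⟨rfl, h2⟩
      refine ⟨⟨fun hs => ?_, hb.1, h2⟩, rfl⟩
      have := mem_of_sameCycle (S := {0, σ 0}) (by rintro _ (rfl | rfl) <;> simp [h2]) (by simp) hs
      obtain h | h := this
      · exact absurd h (by simp)
      · exact hb.2 h.symm
  · intro σ hσ
    have hσ := (mem_filter.mp hσ).2
    simp only [mem_compl, mem_insert, mem_singleton, not_or]
    exact ⟨hσ.2.1, fun h1 => hσ.1 ⟨1, by simpa using h1⟩⟩

/-- Let `Q` and `P - Q` be the parts of `P = permSum 1 y (m + 2)` with `0` and `1` in the same and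
in different cycles. The transposition gives `Q = (P - Q) + A - B`, where `A` corrects for fixed `0`
and `B` for `0` in a 2-cycle. Thus `P + A - B = 2 Q`. -/
theorem permSum_one_add_two (y : R) (m : ℕ) :
    permSum 1 y (m + 2) + ((1 - y) * permSum 1 y (m + 1) - m * (y * permSum 1 y m)) =
      2 * ∑ k ∈ range (m + 1), (m.choose k : R) * (cycleSum y (k + 2) * permSum 1 y (m - k)) := by
  rw [← sum_ncmPerms_sameCycle_zero_one, ← sum_ncmPerms_fixed, ← sum_ncmPerms_transposed]
  have hP : permSum 1 y (m + 2) =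
      ∑ σ ∈ ncmPerms pat132 (m + 2) with σ.SameCycle 0 1, y ^ cdes σ +
        ∑ σ ∈ ncmPerms pat132 (m + 2) with ¬ σ.SameCycle 0 1, y ^ cdes σ := by
    rw [sum_filter_add_sum_filter_not, permSum]
    simp
  have hne : (0 : Fin (m + 2)) ≠ 1 := by simp
  have hQ : ∑ σ ∈ ncmPerms pat132 (m + 2) with σ.SameCycle 0 1, y ^ cdes σ =
      ∑ σ with ¬ σ.SameCycle (0 : Fin (m + 2)) 1,
        if Equiv.swap 0 1 * σ ∈ ncmPerms pat132 (m + 2) then y ^ cdes (Equiv.swap 0 1 * σ) else 0 := by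
    have h : (ncmPerms pat132 (m + 2)).filter (fun σ => σ.SameCycle 0 1) =
        (univ.filter fun σ : Equiv.Perm (Fin (m + 2)) => σ.SameCycle 0 1).filter
          fun σ => σ ∈ ncmPerms pat132 (m + 2) := by
      ext σ; simp [and_comm]
    rw [h, sum_filter]
    symm
    refine sum_equiv (Equiv.mulLeft (Equiv.swap 0 1)) (fun σ => ?_) fun σ _ => rfl
    simp [sameCycle_swap_mul_iff hne]
  have hR : ∑ σ ∈ ncmPerms pat132 (m + 2) with ¬ σ.SameCycle 0 1, y ^ cdes σ =
      ∑ σ with ¬ σ.SameCycle (0 : Fin (m + 2)) 1,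
        if σ ∈ ncmPerms pat132 (m + 2) then y ^ cdes σ else 0 := by
    rw [← sum_filter]
    refine sum_congr ?_ fun _ _ => rfl
    ext σ; simp [and_comm]
  have hA : ∑ σ ∈ ncmPerms pat132 (m + 2) with σ 0 = 0, (y ^ (cdes σ - 1) - y ^ cdes σ) =
      ∑ σ with ¬ σ.SameCycle (0 : Fin (m + 2)) 1,
        if σ ∈ ncmPerms pat132 (m + 2) ∧ σ 0 = 0 then y ^ (cdes σ - 1) - y ^ cdes σ else 0 := by
    rw [← sum_filter]
    refine sum_congr ?_ fun _ _ => rfl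
    ext σ
    simp only [mem_filter, mem_univ, true_and]
    refine ⟨fun h => ⟨fun hs => hne ?_, h⟩, fun h => h.2⟩
    exact (mem_of_sameCycle (S := {0}) (by simpa using h.2) rfl hs).symm
  have hB : ∑ σ ∈ ncmPerms pat132 (m + 2) with ¬ σ.SameCycle 0 1 ∧ σ 0 ≠ 0 ∧ σ (σ 0) = 0,
      y ^ cdes σ = ∑ σ with ¬ σ.SameCycle (0 : Fin (m + 2)) 1,
        if σ ∈ ncmPerms pat132 (m + 2) ∧ σ 0 ≠ 0 ∧ σ (σ 0) = 0 then y ^ cdes σ else 0 := by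
    rw [← sum_filter]
    refine sum_congr ?_ fun _ _ => rfl
    ext σ; simp only [mem_filter, mem_univ, true_and]; tauto
  have hmain : ∑ σ ∈ ncmPerms pat132 (m + 2) with σ.SameCycle 0 1, y ^ cdes σ =
      ∑ σ ∈ ncmPerms pat132 (m + 2) with ¬ σ.SameCycle 0 1, y ^ cdes σ +
      (∑ σ ∈ ncmPerms pat132 (m + 2) with σ 0 = 0, (y ^ (cdes σ - 1) - y ^ cdes σ) -
      ∑ σ ∈ ncmPerms pat132 (m + 2) with ¬ σ.SameCycle 0 1 ∧ σ 0 ≠ 0 ∧ σ (σ 0) = 0,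
        y ^ cdes σ) := by
    -- All four sums now range over the permutations separating `0` from `1`, so they are compared
    -- term by term.
    rw [hQ, hR, hA, hB, ← sum_sub_distrib, ← sum_add_distrib]
    refine sum_congr rfl fun σ hσ => ?_
    have hσ : ¬ σ.SameCycle 0 1 := (mem_filter.mp hσ).2
    by_cases h0 : σ 0 = 0
    · simp only [swap_mul_mem_ncmPerms hσ (Or.inl h0), h0]
      have := cdes_swap_mul_of_fixed h0
      rw [this, Nat.add_sub_cancel]
      split_ifs <;> simp_all
    · by_cases h2 : σ (σ 0) = 0
      · simp [swap_mul_notMem_ncmPerms hσ h0 h2, h0, h2]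
      · simp [swap_mul_mem_ncmPerms hσ (Or.inr h2), cdes_swap_mul hσ h0, h0, h2]
  rw [hP]
  linear_combination -hmain

end SwapZeroOne

end CyclePattern

/-- The exponential generating functions of permutations, and of cycles, without cycle
`132`-matches. Taking `R = ℚ[x, y]`, `x` and `y` are indeterminates. -/
theorem mainTheorem2 {R : Type*} [CommRing R] [Algebra ℚ R] (x y : R) :
    CyclePattern.cycleSeries CyclePattern.pat132 y = PowerSeries.logOf (CyclePattern.recip (CyclePattern.denom132 y)) ∧
    CyclePattern.NCM CyclePattern.pat132 x y =
      CyclePattern.expOf (PowerSeries.C x * PowerSeries.logOf (CyclePattern.recip (CyclePattern.denom132 y))) ∧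
    CyclePattern.NCM CyclePattern.pat132 x y = CyclePattern.recip (CyclePattern.powOf (CyclePattern.denom132 y) x) ∧
    CyclePattern.NCM CyclePattern.pat132 x y = CyclePattern.powOf (CyclePattern.denom132 y) (-x) := by
  open CyclePattern in
  have hN : ∀ z : R, PowerSeries.derivative R (egf (permSum z y)) =
      PowerSeries.C z * PowerSeries.derivative R (egf (cycleSum y)) * egf (permSum z y) := by
    intro z
    rw [derivative_egf, derivative_egf, mul_assoc, egf_mul, C_mul_egf]
    exact congrArg egf (funext fun n => permSum_succ z y n)
  have hN0 : ∀ z : R, PowerSeries.constantCoeff (egf (permSum z y)) = 1 := fun z => by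
    rw [constantCoeff_egf, permSum_zero]
  have hF : PowerSeries.derivative R (egf (permSum 1 y)) =
      PowerSeries.derivative R (egf (cycleSum y)) * egf (permSum 1 y) := by
    simpa using hN 1
  have hDF : denom132 y * egf (permSum 1 y) = 1 := by
    refine denom132_mul_eq_one (L := egf (cycleSum y)) (hN0 1) hF
      (by rw [derivative_egf, constantCoeff_egf, cycleSum_one]) ?_
    -- Generating function form of `permSum_one_add_two`; the factor `m` there produces `t F'`.
    have h1 : PowerSeries.derivative R (PowerSeries.derivative R (egf (permSum 1 y))) +
        (PowerSeries.C (1 - y) * PowerSeries.derivative R (egf (permSum 1 y)) +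
          PowerSeries.C (-y) * (PowerSeries.X * PowerSeries.derivative R (egf (permSum 1 y)))) =
        PowerSeries.C 2 * (PowerSeries.derivative R (PowerSeries.derivative R (egf (cycleSum y))) *
          egf (permSum 1 y)) := by
      rw [X_mul_derivative_egf]
      simp only [derivative_egf, egf_mul, C_mul_egf, egf_add]
      refine congrArg egf (funext fun m => ?_)
      rw [← permSum_one_add_two y m]
      ring
    -- Inserting `F'' = L'' F + L' ^ 2 F` cancels one of the two copies of `L'' F`.
    rw [hF, Derivation.leibniz, hF, smul_eq_mul, smul_eq_mul, map_neg, map_ofNat] at h1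
    rw [hF]
    linear_combination -h1
  have hL0 : PowerSeries.constantCoeff (egf (cycleSum y)) = 0 := by
    rw [constantCoeff_egf, cycleSum_zero]
  exact log_exp_identities x (constantCoeff_denom132 y) hDF hL0 hF (hN0 x) (hN x)
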